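/- Let $d,N\ge 0$ be integers and let $L=\partial_t+\sum_{l=1}^d A_l\partial_l$ be an operator acting on functions $U(t,x)\in\mathbb C^N$, $(t,x)\in\mathbb R^{1+d}$, with constant matrices $A_l\in\mathbb C^{N\times N}$. For $\sigma_1,\dots,\sigma_d\in L^\infty(\mathbb R;\mathbb C)$, Bérenger's split operator $\tilde L$ acts on $\tilde U=(U^1,\dots,U^d)\in(\mathbb C^N)^d$ by $$(\tilde L\tilde U)_l=\partial_tU^l+A_l\,\partial_l\Big(\sum_{j=1}^dU^j\Big)+\sigma_l(x_l)\,U^l,\qquad 1\le l\le d.$$ For an operator $\mathcal L=\partial_t+\sum_l\mathcal A_l\partial_l+\mathcal B(x)$ with constant matrices $\mathcal A_l$ and a bounded matrix function $\mathcal B$, the Cauchy problem is called strongly well posed if there are $K>0$ and $\alpha\in\mathbb R$ such that for every $U_0\in L^2(\mathbb R^d)$ there is a unique distributional solution $U\in C^0([0,\infty[;L^2(\mathbb R^d))$ of $\mathcal LU=0$ with $U(0)=U_0$, and $\|U(t)\|_{L^2}\le Ke^{\alpha t}\|U(0)\|_{L^2}$ for all $t\ge0$. The operator $L(0,\partial)=\sum_lA_l\partial_l$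 is elliptic if $\det\big(\sum_l\xi_lA_l\big)\ne0$ for all $\xi\in\mathbb R^d\setminus\{0\}$. **Theorem 3.2.** If the Cauchy problem for $L$ is strongly well posed and $L(0,\partial)$ is elliptic, then for all $\sigma_1,\dots,\sigma_d\in L^\infty(\mathbb R;\mathbb C)$ the Cauchy problem for $\tilde L$ is strongly well posed (in $L^2$, without loss of derivatives). -/

import Mathlib

open MeasureTheory Set
open scoped ENNReal Matrix

noncomputable section

/-- The space `L²(ℝᵈ; ℂ^ι)`, for the Euclidean norms on `ℝᵈ` and `ℂ^ι` and Lebesgue measure. -/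
abbrev L2Space (d : ℕ) (ι : Type) [Fintype ι] : Type :=
  Lp (EuclideanSpace ℂ ι) 2 (volume : Measure (EuclideanSpace ℝ (Fin d)))

/-- `U ∈ C⁰([0,∞[; L²(ℝᵈ; ℂ^ι))` solves `∂ₜU + ∑ₗ Aₗ ∂ₗU + B(x) U = 0` in the sense of (tempered)
distributions: for each test function `ψ` and each component `i`, the function `t ↦ ∫ ψ Uᵢ(t)` is
differentiable on `[0,∞[` (one-sidedly at `0`) with derivative
`∫ ∑ₗ ∂ₗψ (Aₗ U(t))ᵢ - ψ (B U(t))ᵢ`.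
Only the values `U t` with `t ≥ 0` matter. -/
def IsSolution {d : ℕ} {ι : Type} [Fintype ι] (A : Fin d → Matrix ι ι ℂ)
    (B : EuclideanSpace ℝ (Fin d) → Matrix ι ι ℂ) (U : ℝ → L2Space d ι) : Prop :=
  ContinuousOn U (Ici 0) ∧
    ∀ (ψ : SchwartzMap (EuclideanSpace ℝ (Fin d)) ℂ) (i : ι), ∀ t ∈ Ici (0 : ℝ),
      HasDerivWithinAt (fun s : ℝ => ∫ x, ψ x * (U s x) i)
        (∫ x, ((∑ l, fderiv ℝ ψ x (EuclideanSpace.single l 1) * (A l *ᵥ (U t x).ofLp) i)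
          - ψ x * (B x *ᵥ (U t x).ofLp) i))
        (Ici 0) t

/-- The Cauchy problem for `∂ₜ + ∑ₗ Aₗ ∂ₗ + B(x)` is strongly well posed: there are `K > 0` and
`α ∈ ℝ` such that for all initial values in `L²` there is a unique solution in `C⁰([0,∞[; L²)`, and
it satisfies `‖U(t)‖ ≤ K e^{αt} ‖U(0)‖` in `L²` for all `t ≥ 0`. -/
def StronglyWellPosed {d : ℕ} {ι : Type} [Fintype ι] (A : Fin d → Matrix ι ι ℂ)
    (B : EuclideanSpace ℝ (Fin d) → Matrix ι ι ℂ) : Prop :=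
  ∃ K > 0, ∃ α : ℝ, ∀ U₀ : L2Space d ι, ∃ U : ℝ → L2Space d ι,
    IsSolution A B U ∧ U 0 = U₀ ∧
    (∀ t ∈ Ici (0 : ℝ), ‖U t‖ ≤ K * Real.exp (α * t) * ‖U 0‖) ∧
    ∀ V : ℝ → L2Space d ι, IsSolution A B V → V 0 = U₀ → EqOn V U (Ici 0)

/-- `L(0,∂) = ∑ₗ Aₗ ∂ₗ` is elliptic: its symbol is invertible at each real `ξ ≠ 0`. -/
def IsEllipticGenerator {d : ℕ} {ι : Type} [Fintype ι] [DecidableEq ι]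
    (A : Fin d → Matrix ι ι ℂ) : Prop :=
  ∀ ξ : Fin d → ℝ, ξ ≠ 0 → (∑ l, (ξ l : ℂ) • A l).det ≠ 0

/-- The coefficient `Ãₗ` of Bérenger's split operator, acting on `Ũ = (U¹, …, Uᵈ)` with
`Uʲ ∈ ℂᴺ`: its `l`-th block row is `(Aₗ, …, Aₗ)`, its other block rows vanish. -/
def splitCoeff {d N : ℕ} (A : Fin d → Matrix (Fin N) (Fin N) ℂ) (l : Fin d) :
    Matrix (Fin d × Fin N) (Fin d × Fin N) ℂ :=
  Matrix.of fun p q => if p.1 = l then A l p.2 q.2 else 0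

/-- The absorption term of Bérenger's split operator: the block diagonal matrix with blocks
`σⱼ(xⱼ) I_N`. -/
def splitAbsorption {d : ℕ} (N : ℕ) (σ : Fin d → ℝ → ℂ) (x : EuclideanSpace ℝ (Fin d)) :
    Matrix (Fin d × Fin N) (Fin d × Fin N) ℂ :=
  Matrix.diagonal fun p => σ p.1 (x p.1)

end

/-! Take first `σ = 0`. The sum `V = ∑ⱼ Uʲ` of a solution of the split system solves `LV = 0`, and
each component satisfies `∂ₜUˡ = -Aₗ∂ₗV`. Integrating in time, `Uˡ(t) - Uˡ(0) = -Aₗ∂ₗ ∫₀ᵗ V`, while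
`V(t) - V(0) = -L(0,∂) ∫₀ᵗ V`. By ellipticity `Rₗ = Aₗ∂ₗ L(0,∂)⁻¹` is a Fourier multiplier whose
symbol is homogeneous of degree zero and bounded, hence a bounded operator on `L²`, and `Uˡ(t) -
Uˡ(0) = Rₗ(V(t) - V(0))`. The split solution is thus determined by `V` and the initial data, without
loss of derivatives (`rieszOperator_mem`, `MildlyWellPosed.of_slaved`,
`mildlyWellPosed_splitCoeff`).

The absorption is multiplication by an `L^∞` function, a bounded operator on `L²`, and bounded
perturbations preserve strong well-posedness by Duhamel's formula (`MildlyWellPosed.perturb`).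

Both steps use time-integrated equations, expressed as membership in the closed graph of `-L(0,∂)`;
`isSolution_iff_isMildSolution` shows that these are equivalent to the distributional ones. -/

noncomputable section

/-! ### Mild solutions and integrals in Banach spaces. -/

section Mild

variable {E F : Type*} [NormedAddCommGroup E] [NormedSpace ℝ E]
  [NormedAddCommGroup F] [NormedSpace ℝ F]

/-- `U ∈ C⁰([0,∞[; E)` is a mild solution of `U' + B U = 𝒢 U`, where the graph of the unbounded
operator `𝒢` is the linear relation `G`. -/
def IsMildSolution (G : Submodule ℝ (E × E)) (B : E →L[ℝ] E) (U : ℝ → E) : Prop :=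
  ContinuousOn U (Ici 0) ∧
    ∀ t ∈ Ici (0 : ℝ), (∫ s in (0 : ℝ)..t, U s, U t - U 0 + ∫ s in (0 : ℝ)..t, B (U s)) ∈ G

/-- Strong well-posedness of the Cauchy problem for `U' + B U = 𝒢 U` in the mild sense. -/
def MildlyWellPosed (G : Submodule ℝ (E × E)) (B : E →L[ℝ] E) : Prop :=
  ∃ K > 0, ∃ α : ℝ, ∀ U₀ : E, ∃ U : ℝ → E,
    IsMildSolution G B U ∧ U 0 = U₀ ∧
    (∀ t ∈ Ici (0 : ℝ), ‖U t‖ ≤ K * Real.exp (α * t) * ‖U 0‖) ∧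
    ∀ V : ℝ → E, IsMildSolution G B V → V 0 = U₀ → EqOn V U (Ici 0)

omit [NormedSpace ℝ E] in
theorem intervalIntegrable_of_continuousOn_Ici {f : ℝ → E} (hf : ContinuousOn f (Ici 0)) {t : ℝ}
    (ht : 0 ≤ t) : IntervalIntegrable f volume 0 t :=
  (hf.mono (by rw [uIcc_of_le ht]; exact Icc_subset_Ici_self)).intervalIntegrable

theorem integral_congr_Ici {f g : ℝ → E} (h : EqOn f g (Ici 0)) {t : ℝ} (ht : 0 ≤ t) :
    ∫ s in (0 : ℝ)..t, f s = ∫ s in (0 : ℝ)..t, g s :=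
  intervalIntegral.integral_congr fun s hs => h (by rw [uIcc_of_le ht] at hs; exact hs.1)

theorem IsMildSolution.add {G : Submodule ℝ (E × E)} {B : E →L[ℝ] E} {U V : ℝ → E}
    (hU : IsMildSolution G B U) (hV : IsMildSolution G B V) :
    IsMildSolution G B (fun t => U t + V t) := by
  refine ⟨hU.1.add hV.1, fun t ht => ?_⟩
  convert G.add_mem (hU.2 t ht) (hV.2 t ht) using 1
  have h1 := intervalIntegrable_of_continuousOn_Ici hU.1 ht
  have h2 := intervalIntegrable_of_continuousOn_Ici hV.1 ht
  have h3 := intervalIntegrable_of_continuousOn_Ici (B.continuous.comp_continuousOn hU.1) ht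
  have h4 := intervalIntegrable_of_continuousOn_Ici (B.continuous.comp_continuousOn hV.1) ht
  simp only [Function.comp_def] at h3 h4
  simp only [Prod.mk_add_mk, map_add, intervalIntegral.integral_add h1 h2,
    intervalIntegral.integral_add h3 h4]
  congr 1
  abel

theorem IsMildSolution.smul {G : Submodule ℝ (E × E)} {B : E →L[ℝ] E} {U : ℝ → E} (c : ℝ)
    (hU : IsMildSolution G B U) : IsMildSolution G B (fun t => c • U t) := by
  refine ⟨hU.1.const_smul c, fun t ht => ?_⟩
  convert G.smul_mem c (hU.2 t ht) using 1
  simp [smul_add, smul_sub]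

theorem IsMildSolution.congr {G : Submodule ℝ (E × E)} {B : E →L[ℝ] E} {U V : ℝ → E}
    (hU : IsMildSolution G B U) (h : EqOn V U (Ici 0)) : IsMildSolution G B V := by
  refine ⟨hU.1.congr h, fun t ht => ?_⟩
  rw [integral_congr_Ici h ht, integral_congr_Ici (f := fun s => B (V s)) (g := fun s => B (U s))
    (fun s hs => by simp only [h hs]) ht, h ht, h (mem_Ici.2 le_rfl)]
  exact hU.2 t ht

/-- Fubini's theorem on a triangle. -/
theorem intervalIntegral_triangle_swap {f : ℝ → ℝ → E} (hf : Continuous (Function.uncurry f))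
    {t : ℝ} (ht : 0 ≤ t) :
    ∫ r in (0 : ℝ)..t, ∫ s in (0 : ℝ)..r, f r s = ∫ s in (0 : ℝ)..t, ∫ r in s..t, f r s := by
  set g : ℝ → ℝ → E := fun r s => {p : ℝ × ℝ | p.2 ≤ p.1}.indicator (Function.uncurry f) (r, s)
  have hmeas : MeasurableSet {p : ℝ × ℝ | p.2 ≤ p.1} :=
    measurableSet_le measurable_snd measurable_fst
  have hint : Integrable (Function.uncurry g)
      ((volume.restrict (Ioc 0 t)).prod (volume.restrict (Ioc 0 t))) := by
    have : Function.uncurry g = {p : ℝ × ℝ | p.2 ≤ p.1}.indicator (Function.uncurry f) := by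
      ext ⟨r, s⟩; rfl
    rw [this, Measure.prod_restrict]
    refine Integrable.indicator ?_ hmeas
    exact (hf.continuousOn.integrableOn_compact (isCompact_Icc.prod isCompact_Icc)).mono_set
      (prod_mono Ioc_subset_Icc_self Ioc_subset_Icc_self)
  have hswap := integral_integral_swap hint
  rw [intervalIntegral.integral_of_le ht, intervalIntegral.integral_of_le ht]
  have h1 : ∀ r ∈ Ioc 0 t, ∫ s in (0 : ℝ)..r, f r s = ∫ s in Ioc 0 t, g r s := by
    intro r hr
    have : (fun s => g r s) = (Iic r).indicator (f r) := by
      ext s; by_cases h : s ≤ r <;> simp [g, h]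
    rw [this, setIntegral_indicator measurableSet_Iic, intervalIntegral.integral_of_le hr.1.le]
    congr 2
    ext s
    simp only [mem_Ioc, mem_inter_iff, mem_Iic]
    exact ⟨fun h => ⟨⟨h.1, h.2.trans hr.2⟩, h.2⟩, fun h => ⟨h.1.1, h.2⟩⟩
  have h2 : ∀ s ∈ Ioc 0 t, ∫ r in s..t, f r s = ∫ r in Ioc 0 t, g r s := by
    intro s hs
    have : (fun r => g r s) = (Ici s).indicator (fun r => f r s) := by
      ext r; by_cases h : s ≤ r <;> simp [g, h]
    rw [this, setIntegral_indicator measurableSet_Ici, intervalIntegral.integral_of_le hs.2,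
      ← integral_Icc_eq_integral_Ioc]
    congr 2
    ext r
    simp only [mem_Ioc, mem_inter_iff, mem_Ici, mem_Icc]
    exact ⟨fun h => ⟨⟨hs.1.trans_le h.1, h.2⟩, h.1⟩, fun h => ⟨h.2, h.1.2⟩⟩
  rw [setIntegral_congr_fun measurableSet_Ioc h1, setIntegral_congr_fun measurableSet_Ioc h2]
  exact hswap

theorem intervalIntegral_pair [CompleteSpace E] [CompleteSpace F] {f : ℝ → E} {g : ℝ → F}
    (hf : Continuous f) (hg : Continuous g) {t : ℝ} (ht : 0 ≤ t) :
    ∫ s in (0 : ℝ)..t, (f s, g s) = (∫ s in (0 : ℝ)..t, f s, ∫ s in (0 : ℝ)..t, g s) := by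
  simp only [intervalIntegral.integral_of_le ht]
  exact integral_pair (hf.intervalIntegrable 0 t).1 (hg.intervalIntegrable 0 t).1

/-- A closed subspace is complete, so the integral can be computed inside it. The projection onto
`[0,t]` extends the integrand, which is known to lie in `G` only there. -/
theorem Submodule.intervalIntegral_mem [CompleteSpace F] {G : Submodule ℝ F}
    (hG : IsClosed (G : Set F)) {p : ℝ → F} (hp : Continuous p) {t : ℝ} (ht : 0 ≤ t)
    (h : ∀ s ∈ Icc 0 t, p s ∈ G) : ∫ s in (0 : ℝ)..t, p s ∈ G := by
  have : CompleteSpace G := hG.completeSpace_coe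
  set q : ℝ → G := fun s => ⟨p (projIcc 0 t ht s), h _ (projIcc 0 t ht s).2⟩
  have hq : Continuous q :=
    (hp.comp (continuous_subtype_val.comp continuous_projIcc)).subtype_mk _
  have key : ∫ s in (0 : ℝ)..t, p s = G.subtypeL (∫ s in (0 : ℝ)..t, q s) := by
    rw [← ContinuousLinearMap.intervalIntegral_comp_comm _ (hq.intervalIntegrable _ _)]
    refine intervalIntegral.integral_congr fun s hs => ?_
    rw [uIcc_of_le ht] at hs
    simp [q, projIcc_of_mem ht hs]
  rw [key]
  exact (∫ s in (0 : ℝ)..t, q s).2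

end Mild

/-! ### Duhamel's formula, bounded perturbations and slaved systems. -/

section Perturbation

variable {E : Type*} [NormedAddCommGroup E] [NormedSpace ℝ E]

/-- A strongly continuous family of operators `T t`, frozen for `t ≤ 0`, whose orbits are the mild
solutions of the unperturbed problem for `G`, with growth `K e^{αt}`. -/
structure IsPropagator (G : Submodule ℝ (E × E)) (K α : ℝ) (T : ℝ → E →L[ℝ] E) : Prop where
  pos : 0 < K
  continuous_apply : ∀ x, Continuous fun t => T t x
  norm_apply_le : ∀ t x, ‖T t x‖ ≤ K * Real.exp (α * max t 0) * ‖x‖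
  zero_apply : ∀ x, T 0 x = x
  isMildSolution : ∀ x, IsMildSolution G 0 fun t => T t x
  unique : ∀ x V, IsMildSolution G 0 V → V 0 = x → EqOn V (fun t => T t x) (Ici 0)

theorem MildlyWellPosed.exists_propagator {G : Submodule ℝ (E × E)} (h : MildlyWellPosed G 0) :
    ∃ K α T, IsPropagator G K α T := by
  obtain ⟨K, hK, α, h⟩ := h
  choose S hS hS0 hSb hSu using h
  -- Uniqueness makes the solution map linear; the growth estimate then makes it continuous.
  have hadd : ∀ x y, ∀ t ∈ Ici (0 : ℝ), S (x + y) t = S x t + S y t := fun x y t ht =>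
    (hSu (x + y) _ ((hS x).add (hS y)) (by simp [hS0]) ht).symm
  have hsmul : ∀ (c : ℝ) x, ∀ t ∈ Ici (0 : ℝ), S (c • x) t = c • S x t := fun c x t ht =>
    (hSu (c • x) _ ((hS x).smul c) (by simp [hS0]) ht).symm
  have hm : ∀ t : ℝ, max t 0 ∈ Ici (0 : ℝ) := fun t => le_max_right t 0
  let T : ℝ → E →L[ℝ] E := fun t => LinearMap.mkContinuous
    { toFun := fun x => S x (max t 0)
      map_add' := fun x y => hadd x y _ (hm t)
      map_smul' := fun c x => hsmul c x _ (hm t) } (K * Real.exp (α * max t 0)) fun x => by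
        simpa [hS0] using hSb x (max t 0) (hm t)
  have hT : ∀ t x, T t x = S x (max t 0) := fun t x => rfl
  have hTe : ∀ x, EqOn (fun t => T t x) (S x) (Ici 0) := fun x t ht => by
    simp only [hT]; rw [max_eq_left (mem_Ici.1 ht)]
  refine ⟨K, α, T, hK, fun x => ?_, fun t x => ?_, fun x => ?_, fun x => ?_, fun x V hV hV0 => ?_⟩
  · simp only [hT]
    exact (hS x).1.comp_continuous (continuous_id.max continuous_const) hm
  · simpa [hS0, hT] using hSb x (max t 0) (hm t)
  · simp [hT, hS0]
  · exact (hS x).congr (hTe x)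
  · exact (hSu x V hV hV0).trans (hTe x).symm

namespace IsPropagator

variable {G : Submodule ℝ (E × E)} {K α : ℝ} {T : ℝ → E →L[ℝ] E}

/-- Strong continuity becomes joint continuity because the operator norms are locally bounded in
time. -/
theorem continuous_uncurry (hT : IsPropagator G K α T) :
    Continuous fun p : ℝ × E => T p.1 p.2 := by
  rw [continuous_iff_continuousAt]
  rintro ⟨t₀, x₀⟩
  have h1 : Filter.Tendsto (fun p : ℝ × E => T p.1 (p.2 - x₀)) (nhds (t₀, x₀)) (nhds 0) := by
    refine squeeze_zero_norm (fun p => hT.norm_apply_le p.1 _) ?_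
    have : Continuous fun p : ℝ × E => K * Real.exp (α * max p.1 0) * ‖p.2 - x₀‖ := by fun_prop
    simpa using this.tendsto (t₀, x₀)
  have h2 : Filter.Tendsto (fun p : ℝ × E => T p.1 x₀) (nhds (t₀, x₀)) (nhds (T t₀ x₀)) :=
    ((hT.continuous_apply x₀).comp continuous_fst).tendsto (t₀, x₀)
  simpa [ContinuousAt] using h1.add h2

theorem continuous_kernel (hT : IsPropagator G K α T) {f : ℝ → E} (hf : Continuous f) :
    Continuous (Function.uncurry fun r s => T (r - s) (f s)) :=
  hT.continuous_uncurry.comp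
    ((continuous_fst.sub continuous_snd).prodMk (hf.comp continuous_snd))

theorem intervalIntegrable_kernel (hT : IsPropagator G K α T) {f : ℝ → E} (hf : Continuous f)
    (t a b : ℝ) : IntervalIntegrable (fun s => T (t - s) (f s)) volume a b :=
  ((hT.continuous_kernel hf).comp (Continuous.prodMk_right t)).intervalIntegrable _ _

/-- The Duhamel integral of a continuous source. -/
def _root_.duhamel (T : ℝ → E →L[ℝ] E) (f : ℝ → E) (t : ℝ) : E :=
  ∫ s in (0 : ℝ)..t, T (t - s) (f s)

theorem continuous_duhamel (hT : IsPropagator G K α T) {f : ℝ → E} (hf : Continuous f) :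
    Continuous (duhamel T f) :=
  intervalIntegral.continuous_parametric_intervalIntegral_of_continuous (hT.continuous_kernel hf)
    continuous_id

/-- The Duhamel integral is a mild solution with source `f`: for fixed `s`, the orbit of `f s`
started at time `s` gives an element of `G`. Integrating over `s` stays in the closed `G`, and
Fubini on the triangle identifies the first component. -/
theorem duhamel_mem [CompleteSpace E] (hG : IsClosed (G : Set (E × E)))
    (hT : IsPropagator G K α T) {f : ℝ → E} (hf : Continuous f) {t : ℝ} (ht : 0 ≤ t) :
    (∫ s in (0 : ℝ)..t, duhamel T f s, duhamel T f t - ∫ s in (0 : ℝ)..t, f s) ∈ G := by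
  have hk := hT.continuous_kernel hf
  let p : ℝ → E × E := fun s => (∫ r in s..t, T (r - s) (f s), T (t - s) (f s) - f s)
  have hp1 : Continuous fun s => ∫ r in s..t, T (r - s) (f s) := by
    have : (fun s => ∫ r in s..t, T (r - s) (f s))
        = fun s => -∫ r in t..s, T (r - s) (f s) := by
      ext s; rw [intervalIntegral.integral_symm]
    rw [this]
    exact (intervalIntegral.continuous_parametric_intervalIntegral_of_continuous
      (f := fun s r => T (r - s) (f s)) (hk.comp continuous_swap) continuous_id).neg
  have hp2 : Continuous fun s => T (t - s) (f s) - f s :=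
    (hk.comp (Continuous.prodMk_right t)).sub hf
  have hmem : ∀ s ∈ Icc 0 t, p s ∈ G := by
    intro s hs
    have := (hT.isMildSolution (f s)).2 (t - s) (sub_nonneg.2 hs.2)
    simp only [_root_.zero_apply, intervalIntegral.integral_zero, add_zero,
      hT.zero_apply] at this
    convert this using 2
    simp [intervalIntegral.integral_comp_sub_right (fun r => T r (f s)) s]
  convert Submodule.intervalIntegral_mem hG (hp1.prodMk hp2) ht hmem using 1
  refine Eq.trans ?_ (intervalIntegral_pair hp1 hp2 ht).symm
  congr 1
  · exact intervalIntegral_triangle_swap hk ht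
  · rw [intervalIntegral.integral_sub (hT.intervalIntegrable_kernel hf _ _ _)
      (hf.intervalIntegrable _ _)]
    rfl

/-- In the norm weighted by `e^{-λt}`, the Duhamel operator gains the factor `1/(λ - α)`, small for
large `λ`; this drives the contraction below. -/
theorem norm_duhamel_le (hT : IsPropagator G K α T) {f : ℝ → E} {t C lam : ℝ} (ht : 0 ≤ t)
    (hlam : α < lam) (hC : 0 ≤ C) (hfC : ∀ s ∈ Icc 0 t, ‖f s‖ ≤ C * Real.exp (lam * s)) :
    ‖duhamel T f t‖ ≤ K * C / (lam - α) * Real.exp (lam * t) := by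
  have hpos : 0 < lam - α := sub_pos.2 hlam
  have hK := hT.pos
  set P : ℝ → ℝ := fun s => K * C / (lam - α) * Real.exp (α * (t - s) + lam * s) with hP
  have hder : ∀ s : ℝ, HasDerivAt P (K * C * Real.exp (α * (t - s) + lam * s)) s := by
    intro s
    have h1 : HasDerivAt (fun s : ℝ => α * (t - s) + lam * s) (α * (-1) + lam * 1) s :=
      (((hasDerivAt_id s).const_sub t).const_mul α).add ((hasDerivAt_id s).const_mul lam)
    refine (h1.exp.const_mul (K * C / (lam - α))).congr_deriv ?_
    field_simp
    ring
  have hcont : Continuous fun s => K * C * Real.exp (α * (t - s) + lam * s) := by fun_prop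
  calc ‖duhamel T f t‖ ≤ ∫ s in (0 : ℝ)..t, K * C * Real.exp (α * (t - s) + lam * s) := by
        refine intervalIntegral.norm_integral_le_of_norm_le ht (ae_of_all _ fun s hs => ?_)
          (hcont.intervalIntegrable _ _)
        refine (hT.norm_apply_le _ _).trans ?_
        rw [max_eq_left (sub_nonneg.2 hs.2), Real.exp_add]
        have := hfC s ⟨hs.1.le, hs.2⟩
        calc K * Real.exp (α * (t - s)) * ‖f s‖
            ≤ K * Real.exp (α * (t - s)) * (C * Real.exp (lam * s)) := by gcongr
          _ = _ := by ring
    _ = P t - P 0 := intervalIntegral.integral_eq_sub_of_hasDerivAt (fun s _ => hder s)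
        (hcont.intervalIntegrable _ _)
    _ ≤ P t := by
        have : 0 ≤ P 0 := by positivity
        linarith
    _ = _ := by simp [hP]

theorem duhamel_sub (hT : IsPropagator G K α T) {f g : ℝ → E} (hf : Continuous f)
    (hg : Continuous g) (t : ℝ) :
    duhamel T (fun s => f s - g s) t = duhamel T f t - duhamel T g t := by
  simp only [duhamel, map_sub]
  exact intervalIntegral.integral_sub (hT.intervalIntegrable_kernel hf _ _ _)
    (hT.intervalIntegrable_kernel hg _ _ _)

/-- Solutions of the Volterra equation `U = T U₀ - ∫ T(t - s) B U(s) ds` are mild solutions of the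
perturbed problem. -/
theorem isMildSolution_of_volterra [CompleteSpace E] (hG : IsClosed (G : Set (E × E)))
    (hT : IsPropagator G K α T) (B : E →L[ℝ] E) {U : ℝ → E} (hU : Continuous U) (x : E)
    (h : ∀ t ∈ Ici (0 : ℝ), U t = T t x - duhamel T (fun s => B (U s)) t) :
    IsMildSolution G B U := by
  refine ⟨hU.continuousOn, fun t ht => ?_⟩
  have hBU : Continuous fun s => B (U s) := B.continuous.comp hU
  have h0 : U 0 = x := by
    rw [h 0 (mem_Ici.2 le_rfl)]; simp [duhamel, hT.zero_apply]
  have h1 := (hT.isMildSolution x).2 t ht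
  have h2 := hT.duhamel_mem hG hBU (mem_Ici.1 ht)
  convert G.sub_mem h1 h2 using 1
  rw [Prod.mk_sub_mk]
  congr 1
  · rw [← intervalIntegral.integral_sub ((hT.continuous_apply x).intervalIntegrable _ _)
      ((hT.continuous_duhamel hBU).intervalIntegrable _ _)]
    exact integral_congr_Ici h ht
  · rw [h0, h t ht]
    simp [hT.zero_apply]
    abel

/-- A mild solution of the perturbed problem with zero initial value satisfies the Volterra
equation. -/
theorem volterra_of_isMildSolution [CompleteSpace E] (hG : IsClosed (G : Set (E × E)))
    (hT : IsPropagator G K α T) (B : E →L[ℝ] E) {W : ℝ → E} (hW : Continuous W)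
    (hmild : IsMildSolution G B W) (h0 : W 0 = 0) {t : ℝ} (ht : 0 ≤ t) :
    W t = - duhamel T (fun s => B (W s)) t := by
  have hBW : Continuous fun s => B (W s) := B.continuous.comp hW
  have hD := hT.continuous_duhamel hBW
  -- Adding the Duhamel integral cancels the term `B W`, so the sum is an unperturbed mild solution
  -- with zero data and vanishes.
  have hsum : IsMildSolution G 0 fun t => W t + duhamel T (fun s => B (W s)) t := by
    refine ⟨(hW.add hD).continuousOn, fun t ht => ?_⟩
    convert G.add_mem (hmild.2 t ht) (hT.duhamel_mem hG hBW (mem_Ici.1 ht)) using 1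
    rw [Prod.mk_add_mk]
    congr 1
    · exact intervalIntegral.integral_add (hW.intervalIntegrable _ _) (hD.intervalIntegrable _ _)
    · simp [h0, duhamel]
  have := hT.unique 0 _ hsum (by simp [h0, duhamel]) (mem_Ici.2 ht)
  simp only [map_zero] at this
  exact eq_neg_of_add_eq_zero_left this

/-- Gronwall's inequality is applied to `y t = ∫₀ᵗ ‖W‖`, which is differentiable although `W` need
not be. -/
theorem eq_zero_of_volterra (hT : IsPropagator G K α T) (B : E →L[ℝ] E) {W : ℝ → E}
    (hW : Continuous W) (h : ∀ t ∈ Ici (0 : ℝ), W t = - duhamel T (fun s => B (W s)) t) :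
    ∀ t ∈ Ici (0 : ℝ), W t = 0 := by
  intro τ hτ
  have hK := hT.pos
  set C : ℝ := K * Real.exp (|α| * τ) * ‖B‖ with hC
  set y : ℝ → ℝ := fun t => ∫ s in (0 : ℝ)..t, ‖W s‖ with hy
  have hyd : ∀ t, HasDerivAt y ‖W t‖ t := fun t =>
    intervalIntegral.integral_hasDerivAt_right (hW.norm.intervalIntegrable _ _)
      (hW.norm.stronglyMeasurableAtFilter _ _) hW.norm.continuousAt
  have hy0 : ∀ t ∈ Icc 0 τ, 0 ≤ y t := fun t ht =>
    intervalIntegral.integral_nonneg ht.1 fun s _ => norm_nonneg _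
  have hbound : ∀ t ∈ Icc 0 τ, ‖W t‖ ≤ C * y t := by
    intro t ht
    rw [h t ht.1, norm_neg, hy, ← intervalIntegral.integral_const_mul]
    refine intervalIntegral.norm_integral_le_of_norm_le ht.1 (ae_of_all _ fun s hs => ?_)
      ((hW.norm.const_mul C).intervalIntegrable _ _)
    refine (hT.norm_apply_le _ _).trans ?_
    rw [max_eq_left (sub_nonneg.2 hs.2), hC, mul_assoc (K * _) ‖B‖]
    gcongr
    · exact sub_nonneg.2 hs.2
    · exact le_abs_self α
    · linarith [hs.1, ht.2]
    · exact B.le_opNorm _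
  have hgron := norm_le_gronwallBound_of_norm_deriv_right_le (f := y) (f' := fun t => ‖W t‖)
    (δ := 0) (K := C) (ε := 0) (a := 0) (b := τ)
    (fun t _ => (hyd t).continuousAt.continuousWithinAt) (fun t _ => (hyd t).hasDerivWithinAt)
    (by simp [hy]) (fun t ht => by
      have ht' : t ∈ Icc 0 τ := ⟨ht.1, ht.2.le⟩
      rw [norm_norm, add_zero, Real.norm_of_nonneg (hy0 t ht')]
      exact hbound t ht')
  have hτ' : τ ∈ Icc 0 τ := ⟨hτ, le_rfl⟩
  have h1 := hgron τ hτ'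
  rw [gronwallBound_ε0, zero_mul] at h1
  have h2 := hbound τ hτ'
  rw [norm_le_zero_iff.1 h1, mul_zero] at h2
  exact norm_le_zero_iff.1 h2

/-- Banach's fixed point theorem for `g(t) = e^{-λt} U(t)` among bounded continuous functions. The
choice of `λ` makes the contraction constant `1/2`, and `‖g‖ ≤ K‖x‖ + ‖g‖/2` yields the factor `2K`.
The `+ 1` ensures `α < λ` even if `B = 0`. -/
theorem exists_volterra [CompleteSpace E] (hT : IsPropagator G K α T) (B : E →L[ℝ] E) {lam : ℝ}
    (hlam : α + 2 * K * (‖B‖ + 1) ≤ lam) (x : E) :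
    ∃ U : ℝ → E, Continuous U ∧
      (∀ t ∈ Ici (0 : ℝ), U t = T t x - duhamel T (fun s => B (U s)) t) ∧
      ∀ t ∈ Ici (0 : ℝ), ‖U t‖ ≤ 2 * K * Real.exp (lam * t) * ‖x‖ := by
  have hK := hT.pos
  have hαlam : α < lam := by
    have : 0 < 2 * K * (‖B‖ + 1) := by positivity
    linarith
  have hhalf : K * ‖B‖ / (lam - α) ≤ 1 / 2 := by
    rw [div_le_iff₀ (sub_pos.2 hαlam)]
    nlinarith [norm_nonneg B]
  let src : BoundedContinuousFunction ℝ E → ℝ → E := fun g s => B (Real.exp (lam * s) • g s)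
  have hsrc : ∀ g, Continuous (src g) := fun g => by
    have := g.continuous
    exact B.continuous.comp (by fun_prop)
  have hDu : ∀ (f : ℝ → E) (C : ℝ), 0 ≤ C → (∀ s, ‖f s‖ ≤ ‖B‖ * C * Real.exp (lam * s)) →
      ∀ m : ℝ, 0 ≤ m → ‖Real.exp (-(lam * m)) • duhamel T f m‖ ≤ 1 / 2 * C := by
    intro f C hC hf m hm
    have h1 := hT.norm_duhamel_le hm hαlam (C := ‖B‖ * C) (by positivity) fun s _ => hf s
    rw [norm_smul, Real.norm_of_nonneg (Real.exp_nonneg _)]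
    calc Real.exp (-(lam * m)) * ‖duhamel T f m‖
        ≤ Real.exp (-(lam * m)) * (K * (‖B‖ * C) / (lam - α) * Real.exp (lam * m)) := by gcongr
      _ = K * ‖B‖ / (lam - α) * C := by rw [Real.exp_neg]; field_simp
      _ ≤ _ := by gcongr
  have hsrcb : ∀ g s, ‖src g s‖ ≤ ‖B‖ * ‖g‖ * Real.exp (lam * s) := fun g s => by
    refine (B.le_opNorm _).trans ?_
    rw [norm_smul, Real.norm_of_nonneg (Real.exp_nonneg _), mul_assoc, mul_comm ‖g‖]
    have := g.norm_coe_le_norm s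
    gcongr
  have hTb : ∀ m : ℝ, 0 ≤ m → ‖Real.exp (-(lam * m)) • T m x‖ ≤ K * ‖x‖ := fun m hm => by
    rw [norm_smul, Real.norm_of_nonneg (Real.exp_nonneg _)]
    have h1 := hT.norm_apply_le m x
    rw [max_eq_left hm] at h1
    calc Real.exp (-(lam * m)) * ‖T m x‖
        ≤ Real.exp (-(lam * m)) * (K * Real.exp (α * m) * ‖x‖) := by gcongr
      _ ≤ Real.exp (-(lam * m)) * (K * Real.exp (lam * m) * ‖x‖) := by gcongr
      _ = K * ‖x‖ := by rw [Real.exp_neg]; field_simp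
  let val : BoundedContinuousFunction ℝ E → ℝ → E := fun g m =>
    Real.exp (-(lam * m)) • T m x - Real.exp (-(lam * m)) • duhamel T (src g) m
  have hval : ∀ g, Continuous (val g) := fun g => by
    have h1 := hT.continuous_apply x
    have h2 := hT.continuous_duhamel (hsrc g)
    fun_prop
  have hvalb : ∀ g m, 0 ≤ m → ‖val g m‖ ≤ K * ‖x‖ + 1 / 2 * ‖g‖ := fun g m hm =>
    (norm_sub_le _ _).trans (add_le_add (hTb m hm) (hDu _ _ (norm_nonneg _) (hsrcb g) m hm))
  let Φ : BoundedContinuousFunction ℝ E → BoundedContinuousFunction ℝ E := fun g =>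
    BoundedContinuousFunction.ofNormedAddCommGroup (fun t => val g (max t 0))
      ((hval g).comp (continuous_id.max continuous_const)) _
      fun t => hvalb g (max t 0) (le_max_right t 0)
  have hΦ : ContractingWith (1 / 2 : NNReal) Φ := by
    refine ⟨by rw [← NNReal.coe_lt_coe]; norm_num, LipschitzWith.of_dist_le_mul fun g g' => ?_⟩
    rw [BoundedContinuousFunction.dist_le (by positivity)]
    intro t
    rw [dist_eq_norm, dist_eq_norm]
    have h1 : Φ g t - Φ g' t = - (Real.exp (-(lam * max t 0)) •
        duhamel T (fun s => src g s - src g' s) (max t 0)) := by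
      rw [hT.duhamel_sub (hsrc g) (hsrc g')]
      simp only [Φ, val, BoundedContinuousFunction.coe_ofNormedAddCommGroup, smul_sub]
      abel
    rw [h1, norm_neg]
    have h2 := hDu (fun s => src g s - src g' s) ‖g - g'‖ (norm_nonneg _) (fun s => by
      have : src g s - src g' s = src (g - g') s := by simp [src, smul_sub]
      rw [this]; exact hsrcb _ s) (max t 0) (le_max_right t 0)
    simpa using h2
  obtain ⟨g, hg⟩ : ∃ g, Φ g = g := ⟨hΦ.fixedPoint Φ, hΦ.fixedPoint_isFixedPt⟩
  have hgt : ∀ t ∈ Ici (0 : ℝ), g t = val g t := fun t ht => by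
    conv_lhs => rw [← hg]
    simp only [Φ, BoundedContinuousFunction.coe_ofNormedAddCommGroup, max_eq_left (mem_Ici.1 ht)]
  have hgn : ‖g‖ ≤ 2 * (K * ‖x‖) := by
    have : ‖g‖ ≤ K * ‖x‖ + 1 / 2 * ‖g‖ := by
      conv_lhs => rw [← hg]
      exact BoundedContinuousFunction.norm_ofNormedAddCommGroup_le _ (by positivity) _
    linarith
  refine ⟨fun t => Real.exp (lam * t) • g t, ?_, fun t ht => ?_, fun t ht => ?_⟩
  · have := g.continuous
    fun_prop
  · change Real.exp (lam * t) • g t = T t x - duhamel T (src g) t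
    rw [hgt t ht]
    simp only [val]
    rw [← smul_sub, smul_smul, ← Real.exp_add, add_neg_cancel, Real.exp_zero, one_smul]
  · rw [norm_smul, Real.norm_of_nonneg (Real.exp_nonneg _)]
    calc Real.exp (lam * t) * ‖g t‖ ≤ Real.exp (lam * t) * (2 * (K * ‖x‖)) := by
          gcongr
          exact (g.norm_coe_le_norm t).trans hgn
      _ = _ := by ring

end IsPropagator

/-- Strong well-posedness is stable under bounded perturbations. -/
theorem MildlyWellPosed.perturb [CompleteSpace E] {G : Submodule ℝ (E × E)}
    (hG : IsClosed (G : Set (E × E))) (h : MildlyWellPosed G 0) (B : E →L[ℝ] E) :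
    MildlyWellPosed G B := by
  obtain ⟨K, α, T, hT⟩ := h.exists_propagator
  have hK := hT.pos
  refine ⟨2 * K, by positivity, α + 2 * K * (‖B‖ + 1), fun x => ?_⟩
  obtain ⟨U, hU, hUv, hUb⟩ := hT.exists_volterra B le_rfl x
  have hUm := hT.isMildSolution_of_volterra hG B hU x hUv
  have hU0 : U 0 = x := by
    rw [hUv 0 (mem_Ici.2 le_rfl)]; simp [duhamel, hT.zero_apply]
  refine ⟨U, hUm, hU0, fun t ht => by rw [hU0]; exact hUb t ht, fun V hV hV0 t ht => ?_⟩
  -- Freezing at negative times makes the difference continuous on all of `ℝ`.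
  set W : ℝ → E := fun t => V (max t 0) + (-1 : ℝ) • U (max t 0) with hWdef
  have hW : Continuous W := by
    have h1 : Continuous fun t : ℝ => V (max t 0) :=
      hV.1.comp_continuous (continuous_id.max continuous_const) fun t => le_max_right t 0
    exact h1.add ((hU.comp (continuous_id.max continuous_const)).const_smul (-1 : ℝ))
  have hWm : IsMildSolution G B W := (hV.add (hUm.smul (-1))).congr fun t ht => by
    simp only [hWdef, max_eq_left (mem_Ici.1 ht)]
  have hW0 : W 0 = 0 := by simp [hWdef, hV0, hU0]
  have := hT.eq_zero_of_volterra B hW (fun t ht => hT.volterra_of_isMildSolution hG B hW hWm hW0 ht)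
    t ht
  simp only [hWdef, max_eq_left (mem_Ici.1 ht)] at this
  rw [neg_one_smul, ← sub_eq_add_neg, sub_eq_zero] at this
  exact this

/-- Transfer of well-posedness to a system `G'` whose solutions are slaved to those of `G`. -/
theorem MildlyWellPosed.of_slaved {E' : Type*} [NormedAddCommGroup E'] [NormedSpace ℝ E']
    [CompleteSpace E] [CompleteSpace E'] {G : Submodule ℝ (E × E)} {G' : Submodule ℝ (E' × E')}
    (S : E' →L[ℝ] E) (P : E →L[ℝ] E')
    (hG : ∀ u f, (u, f) ∈ G' → (S u, S f) ∈ G ∧ f = P (S f))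
    (hP : ∀ u f, (S u, f) ∈ G → (u, P f) ∈ G') (hSP : ∀ u f, (u, f) ∈ G → S (P f) = f)
    (h : MildlyWellPosed G 0) : MildlyWellPosed G' 0 := by
  obtain ⟨K, hK, α, h⟩ := h
  -- The rate is `|α|` because the constant term `x` in `x + P (V t - S x)` need not decay.
  refine ⟨1 + ‖P‖ * ‖S‖ * (K + 1), by positivity, |α|, fun x => ?_⟩
  obtain ⟨V, hV, hV0, hVb, hVu⟩ := h (S x)
  have hV' : ∀ t ∈ Ici (0 : ℝ), (∫ s in (0 : ℝ)..t, V s, V t - S x) ∈ G := fun t ht => by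
    simpa [hV0] using hV.2 t ht
  have hSU : ∀ t ∈ Ici (0 : ℝ), S (x + P (V t - S x)) = V t := fun t ht => by
    rw [map_add, hSP _ _ (hV' t ht)]; abel
  have hUc : ContinuousOn (fun t => x + P (V t - S x)) (Ici 0) := by
    have := hV.1
    fun_prop
  -- Only the increments are slaved: the initial value `x` itself need not lie in the range of `P`.
  refine ⟨fun t => x + P (V t - S x), ⟨hUc, fun t ht => ?_⟩, by simp [hV0], fun t ht => ?_,
    fun W hW hW0 t ht => ?_⟩
  · simp only [_root_.zero_apply, intervalIntegral.integral_zero, add_zero, hV0, sub_self, map_zero,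
      add_sub_cancel_left]
    refine hP _ _ ?_
    rw [← ContinuousLinearMap.intervalIntegral_comp_comm _
      (intervalIntegrable_of_continuousOn_Ici hUc ht), integral_congr_Ici hSU ht]
    exact hV' t ht
  · have he : 1 ≤ Real.exp (|α| * t) := Real.one_le_exp (mul_nonneg (abs_nonneg _) ht)
    have h1 : ‖V t‖ ≤ K * Real.exp (|α| * t) * ‖S x‖ := by
      refine (hVb t ht).trans ?_
      rw [hV0]
      have : α * t ≤ |α| * t := mul_le_mul_of_nonneg_right (le_abs_self α) ht
      gcongr
    have h2 : ‖V t - S x‖ ≤ (K + 1) * Real.exp (|α| * t) * ‖S x‖ := by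
      refine (norm_sub_le _ _).trans ?_
      nlinarith [norm_nonneg (S x)]
    simp only [hV0, sub_self, map_zero, add_zero]
    calc ‖x + P (V t - S x)‖ ≤ ‖x‖ + ‖P‖ * ((K + 1) * Real.exp (|α| * t) * (‖S‖ * ‖x‖)) := by
          refine (norm_add_le _ _).trans (add_le_add le_rfl ((P.le_opNorm _).trans ?_))
          have := S.le_opNorm x
          refine mul_le_mul_of_nonneg_left (h2.trans ?_) (norm_nonneg _)
          gcongr
      _ ≤ Real.exp (|α| * t) * ‖x‖ + ‖P‖ * ((K + 1) * Real.exp (|α| * t) * (‖S‖ * ‖x‖)) := by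
          gcongr
          exact le_mul_of_one_le_left (norm_nonneg _) he
      _ = _ := by ring
  · have hW' : ∀ t ∈ Ici (0 : ℝ), (∫ s in (0 : ℝ)..t, W s, W t - x) ∈ G' := fun t ht => by
      simpa [hW0] using hW.2 t ht
    have hSW : IsMildSolution G 0 fun t => S (W t) := by
      refine ⟨S.continuous.comp_continuousOn hW.1, fun t ht => ?_⟩
      have := (hG _ _ (hW' t ht)).1
      rw [← ContinuousLinearMap.intervalIntegral_comp_comm _
        (intervalIntegrable_of_continuousOn_Ici hW.1 ht), map_sub] at this
      simpa [hW0] using this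
    have h1 := hVu _ hSW (by simp [hW0]) ht
    have h2 := (hG _ _ (hW' t ht)).2
    simp only at h1
    rw [map_sub, h1] at h2
    exact (sub_eq_iff_eq_add'.1 h2)

end Perturbation

/-! ### The distributional graph of the generator and its Fourier description. -/

section Graph

open scoped SchwartzMap LineDeriv FourierTransform

variable {d : ℕ} {ι : Type} [Fintype ι]

/-- The vector-valued pairing `u ↦ ∫ ψ u` with a Schwartz function. -/
def schwartzPairing (ι : Type) [Fintype ι] (ψ : 𝓢(EuclideanSpace ℝ (Fin d), ℂ)) :
    L2Space d ι →L[ℂ] EuclideanSpace ℂ ι :=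
  (ContinuousLinearMap.lsmul ℂ ℂ).lpPairing volume 2 2 (ψ.toLp 2)

theorem schwartzPairing_apply (ψ : 𝓢(EuclideanSpace ℝ (Fin d), ℂ)) (u : L2Space d ι) :
    schwartzPairing ι ψ u = ∫ x, ψ x • u x := by
  rw [schwartzPairing, ContinuousLinearMap.lpPairing_eq_integral]
  refine integral_congr_ae ?_
  filter_upwards [ψ.coeFn_toLp 2 volume] with x hx
  rw [hx]; rfl

theorem schwartzPairing_eq (ψ : 𝓢(EuclideanSpace ℝ (Fin d), ℂ)) (u : L2Space d ι) :
    schwartzPairing ι ψ u = Lp.toTemperedDistribution u ψ := by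
  rw [schwartzPairing_apply, Lp.toTemperedDistribution_apply]

theorem integrable_schwartz_smul (ψ : 𝓢(EuclideanSpace ℝ (Fin d), ℂ)) (u : L2Space d ι) :
    Integrable fun x => ψ x • u x :=
  memLp_one_iff_integrable.1 ((Lp.memLp u).smul (ψ.memLp 2))

theorem schwartzPairing_fourier (φ : 𝓢(EuclideanSpace ℝ (Fin d), ℂ)) (u : L2Space d ι) :
    schwartzPairing ι (𝓕 φ) u = schwartzPairing ι φ (𝓕 u) := by
  rw [schwartzPairing_eq, schwartzPairing_eq, ← Lp.fourier_toTemperedDistribution_eq,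
    TemperedDistribution.fourier_apply]

theorem ae_eq_of_schwartzPairing {f g : EuclideanSpace ℝ (Fin d) → EuclideanSpace ℂ ι}
    (hf : LocallyIntegrable f) (hg : LocallyIntegrable g)
    (h : ∀ φ : 𝓢(EuclideanSpace ℝ (Fin d), ℂ), ∫ x, φ x • f x = ∫ x, φ x • g x) :
    f =ᵐ[volume] g := by
  refine ae_eq_of_integral_contDiff_smul_eq hf hg fun χ hχ hc => ?_
  have h1 : HasCompactSupport (Complex.ofRealCLM ∘ χ) := hc.comp_left rfl
  have h2 : ContDiff ℝ (⊤ : ℕ∞) (Complex.ofRealCLM ∘ χ) := by fun_prop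
  simpa using h (h1.toSchwartzMap h2)

theorem eq_of_schwartzPairing {f g : L2Space d ι}
    (h : ∀ φ : 𝓢(EuclideanSpace ℝ (Fin d), ℂ), schwartzPairing ι φ f = schwartzPairing ι φ g) :
    f = g := by
  refine Lp.ext (ae_eq_of_schwartzPairing ((Lp.memLp f).locallyIntegrable one_le_two)
    ((Lp.memLp g).locallyIntegrable one_le_two) fun φ => ?_)
  simpa [schwartzPairing_apply] using h φ

variable [DecidableEq ι]

/-- The graph of `-∑ₗ Aₗ ∂ₗ` on `L²` in the sense of distributions. -/
def hyperbolicGraph (A : Fin d → Matrix ι ι ℂ) : Submodule ℝ (L2Space d ι × L2Space d ι) where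
  carrier := {p | ∀ ψ : 𝓢(EuclideanSpace ℝ (Fin d), ℂ), schwartzPairing ι ψ p.2 =
    ∑ l, Matrix.toEuclideanCLM (𝕜 := ℂ) (A l)
      (schwartzPairing ι (∂_{EuclideanSpace.single l (1 : ℝ)} ψ) p.1)}
  add_mem' := fun {p q} hp hq ψ => by
    simp only [Prod.snd_add, Prod.fst_add, map_add, hp ψ, hq ψ, Finset.sum_add_distrib]
  zero_mem' := fun ψ => by simp
  smul_mem' := fun c p hp ψ => by
    have h : ∀ (φ : 𝓢(EuclideanSpace ℝ (Fin d), ℂ)) (u : L2Space d ι),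
        schwartzPairing ι φ (c • u) = (c : ℂ) • schwartzPairing ι φ u := fun φ u => by
      rw [← map_smul]; rfl
    simp only [Prod.smul_snd, Prod.smul_fst, h, hp ψ, map_smul, Finset.smul_sum]

theorem mem_hyperbolicGraph {A : Fin d → Matrix ι ι ℂ} {u f : L2Space d ι} :
    (u, f) ∈ hyperbolicGraph A ↔ ∀ ψ : 𝓢(EuclideanSpace ℝ (Fin d), ℂ), schwartzPairing ι ψ f =
      ∑ l, Matrix.toEuclideanCLM (𝕜 := ℂ) (A l)
        (schwartzPairing ι (∂_{EuclideanSpace.single l (1 : ℝ)} ψ) u) := Iff.rfl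

theorem isClosed_hyperbolicGraph (A : Fin d → Matrix ι ι ℂ) :
    IsClosed (hyperbolicGraph A : Set (L2Space d ι × L2Space d ι)) := by
  have : (hyperbolicGraph A : Set (L2Space d ι × L2Space d ι)) =
      ⋂ ψ : 𝓢(EuclideanSpace ℝ (Fin d), ℂ), {p | schwartzPairing ι ψ p.2 =
        ∑ l, Matrix.toEuclideanCLM (𝕜 := ℂ) (A l)
          (schwartzPairing ι (∂_{EuclideanSpace.single l (1 : ℝ)} ψ) p.1)} := by
    ext p; simp only [mem_iInter]; rfl
  rw [this]
  exact isClosed_iInter fun ψ => isClosed_eq (by fun_prop) (by fun_prop)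

/-- The symbol `∑ₗ ξₗ Aₗ` as an operator on `ℂ^ι`. -/
def symbolCLM (A : Fin d → Matrix ι ι ℂ) (ξ : EuclideanSpace ℝ (Fin d)) :
    EuclideanSpace ℂ ι →L[ℂ] EuclideanSpace ℂ ι :=
  ∑ l, (ξ l : ℂ) • Matrix.toEuclideanCLM (𝕜 := ℂ) (A l)

theorem continuous_symbolCLM (A : Fin d → Matrix ι ι ℂ) : Continuous (symbolCLM A) := by
  unfold symbolCLM
  fun_prop

/-- Description of the graph by the Fourier transform. -/
theorem mem_hyperbolicGraph_iff_fourier {A : Fin d → Matrix ι ι ℂ} {u f : L2Space d ι} :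
    (u, f) ∈ hyperbolicGraph A ↔ ∀ᵐ ξ, (𝓕 f : L2Space d ι) ξ =
      (-(2 * Real.pi * Complex.I) : ℂ) • symbolCLM A ξ ((𝓕 u : L2Space d ι) ξ) := by
  set c : ℂ := -(2 * Real.pi * Complex.I) with hc
  set v : EuclideanSpace ℝ (Fin d) → EuclideanSpace ℂ ι := ⇑(𝓕 u : L2Space d ι)
  let M : Fin d → EuclideanSpace ℂ ι →L[ℂ] EuclideanSpace ℂ ι :=
    fun l => Matrix.toEuclideanCLM (𝕜 := ℂ) (A l)
  have hexp : ∀ ξ, c • symbolCLM A ξ (v ξ) = ∑ l, c • (ξ l : ℂ) • M l (v ξ) := fun ξ => by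
    simp [symbolCLM, Finset.smul_sum, M]
  -- The factor `ξ` may destroy square integrability, so the two sides are compared as locally
  -- integrable functions.
  have hloc : LocallyIntegrable fun ξ => c • symbolCLM A ξ (v ξ) := by
    simp only [hexp]
    refine locallyIntegrable_finsetSum _ fun l _ => ?_
    have h1 : LocallyIntegrable fun ξ => M l (v ξ) :=
      ((M l).comp_memLp' (Lp.memLp (𝓕 u : L2Space d ι))).locallyIntegrable one_le_two
    have h2 : Continuous fun ξ : EuclideanSpace ℝ (Fin d) => c * (ξ l : ℂ) := by fun_prop
    simpa only [smul_smul] using h1.continuous_smul h2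
  have key : ∀ φ : 𝓢(EuclideanSpace ℝ (Fin d), ℂ),
      ∑ l, M l (schwartzPairing ι (∂_{EuclideanSpace.single l (1 : ℝ)} (𝓕 φ)) u) =
      ∫ ξ, φ ξ • c • symbolCLM A ξ (v ξ) := by
    intro φ
    let χ : Fin d → 𝓢(EuclideanSpace ℝ (Fin d), ℂ) := fun l => c • SchwartzMap.smulLeftCLM ℂ
      (inner ℝ · (EuclideanSpace.single l (1 : ℝ))) φ
    have hχ : ∀ l ξ, χ l ξ • v ξ = φ ξ • c • (ξ l : ℂ) • v ξ := fun l ξ => by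
      have : (inner ℝ · (EuclideanSpace.single l (1 : ℝ)) :
          EuclideanSpace ℝ (Fin d) → ℝ).HasTemperateGrowth := by fun_prop
      simp only [χ, _root_.smul_apply, SchwartzMap.smulLeftCLM_apply_apply this, smul_smul,
        smul_eq_mul, Complex.real_smul]
      have hin : inner ℝ ξ (EuclideanSpace.single l (1 : ℝ)) = ξ l := by
        simp [EuclideanSpace.inner_single_right]
      rw [hin]
      ring_nf
    have hMχ : ∀ l ξ, M l (χ l ξ • v ξ) = φ ξ • c • (ξ l : ℂ) • M l (v ξ) := fun l ξ => by
      rw [hχ]; simp only [map_smul]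
    have hint : ∀ l, Integrable fun ξ => χ l ξ • v ξ := fun l => integrable_schwartz_smul _ _
    calc _ = ∑ l, M l (∫ ξ, χ l ξ • v ξ) := by
          refine Finset.sum_congr rfl fun l _ => ?_
          rw [SchwartzMap.lineDerivOp_fourier_eq, schwartzPairing_fourier, schwartzPairing_apply]
      _ = ∑ l, ∫ ξ, φ ξ • c • (ξ l : ℂ) • M l (v ξ) := by
          refine Finset.sum_congr rfl fun l _ => ?_
          rw [← ContinuousLinearMap.integral_comp_comm _ (hint l)]
          simp only [hMχ]
      _ = _ := by
          rw [← integral_finsetSum]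
          · simp only [hexp, Finset.smul_sum]
          · intro l _
            simpa only [hMχ] using (M l).integrable_comp (hint l)
  constructor
  · intro h
    refine ae_eq_of_schwartzPairing ((Lp.memLp _).locallyIntegrable one_le_two) hloc fun φ => ?_
    rw [← schwartzPairing_apply, ← schwartzPairing_fourier, h (𝓕 φ)]
    exact key φ
  · intro h ψ
    -- Every test function is a Fourier transform, so `key` covers all of them.
    obtain ⟨φ, rfl⟩ : ∃ φ : 𝓢(EuclideanSpace ℝ (Fin d), ℂ), 𝓕 φ = ψ := ⟨𝓕⁻ ψ, by simp⟩
    rw [key, schwartzPairing_fourier, schwartzPairing_apply]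
    refine integral_congr_ae ?_
    filter_upwards [h] with ξ hξ
    simp only [hξ]

end Graph

/-! ### Equivalence of distributional and mild solutions. -/

section Bridge

open scoped SchwartzMap LineDeriv FourierTransform

/-- The fundamental theorem of calculus on `[0,∞[` in both directions. -/
theorem hasDerivWithinAt_Ici_iff_integral {F : Type*} [NormedAddCommGroup F] [NormedSpace ℝ F]
    [CompleteSpace F] {f g : ℝ → F} (hf : ContinuousOn f (Ici 0)) (hg : ContinuousOn g (Ici 0)) :
    (∀ t ∈ Ici (0 : ℝ), HasDerivWithinAt f (g t) (Ici 0) t) ↔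
      ∀ t ∈ Ici (0 : ℝ), f t - f 0 = ∫ s in (0 : ℝ)..t, g s := by
  constructor
  · intro h t ht
    refine (intervalIntegral.integral_eq_sub_of_hasDeriv_right_of_le (mem_Ici.1 ht)
      (hf.mono Icc_subset_Ici_self) (fun s hs => ?_)
      (intervalIntegrable_of_continuousOn_Ici hg ht)).symm
    exact (h s hs.1.le).mono fun r hr => mem_Ici.2 (hs.1.le.trans (le_of_lt hr))
  · intro h t ht
    have hg' : Continuous fun s : ℝ => g (max s 0) :=
      hg.comp_continuous (continuous_id.max continuous_const) fun s => le_max_right s 0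
    have h1 : HasDerivAt (fun r => f 0 + ∫ s in (0 : ℝ)..r, g (max s 0)) (g (max t 0)) t :=
      (intervalIntegral.integral_hasDerivAt_right (hg'.intervalIntegrable _ _)
        (hg'.stronglyMeasurableAtFilter _ _) hg'.continuousAt).const_add _
    rw [max_eq_left (mem_Ici.1 ht)] at h1
    have h2 : EqOn f (fun r => f 0 + ∫ s in (0 : ℝ)..r, g (max s 0)) (Ici 0) := fun r hr => by
      refine (sub_eq_iff_eq_add'.1 (h r hr)).trans (congrArg _ ?_)
      exact integral_congr_Ici (fun s hs => by simp only [max_eq_left (mem_Ici.1 hs)]) hr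
    exact h1.hasDerivWithinAt.congr h2 (h2 ht)

variable {d : ℕ} {ι : Type} [Fintype ι] [DecidableEq ι]

omit [DecidableEq ι] in
theorem integral_euclidean_apply {α : Type*} [MeasurableSpace α] {μ : Measure α}
    {f : α → EuclideanSpace ℂ ι} (hf : Integrable f μ) (i : ι) :
    (∫ x, f x ∂μ) i = ∫ x, f x i ∂μ :=
  ((EuclideanSpace.proj (𝕜 := ℂ) i).integral_comp_comm hf).symm

/-- The weak form of the spatial operator `-∑ₗ Aₗ ∂ₗ - B`, tested against `ψ`. -/
def weakGenerator (A : Fin d → Matrix ι ι ℂ) (T : L2Space d ι →L[ℂ] L2Space d ι)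
    (ψ : 𝓢(EuclideanSpace ℝ (Fin d), ℂ)) : L2Space d ι →L[ℂ] EuclideanSpace ℂ ι :=
  (∑ l, Matrix.toEuclideanCLM (𝕜 := ℂ) (A l) ∘L
    schwartzPairing ι (∂_{EuclideanSpace.single l (1 : ℝ)} ψ)) - schwartzPairing ι ψ ∘L T

theorem weakGenerator_apply_apply (A : Fin d → Matrix ι ι ℂ)
    {B : EuclideanSpace ℝ (Fin d) → Matrix ι ι ℂ} {T : L2Space d ι →L[ℂ] L2Space d ι}
    (hT : ∀ u, T u =ᵐ[volume] fun x => Matrix.toEuclideanCLM (𝕜 := ℂ) (B x) (u x))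
    (ψ : 𝓢(EuclideanSpace ℝ (Fin d), ℂ)) (u : L2Space d ι) (i : ι) :
    weakGenerator A T ψ u i =
      ∫ x, ((∑ l, fderiv ℝ ψ x (EuclideanSpace.single l 1) * (A l *ᵥ (u x).ofLp) i)
          - ψ x * (B x *ᵥ (u x).ofLp) i) := by
  let M : Fin d → EuclideanSpace ℂ ι →L[ℂ] EuclideanSpace ℂ ι :=
    fun l => Matrix.toEuclideanCLM (𝕜 := ℂ) (A l)
  let ψ' : Fin d → 𝓢(EuclideanSpace ℝ (Fin d), ℂ) :=
    fun l => ∂_{EuclideanSpace.single l (1 : ℝ)} ψ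
  have hint : ∀ l, Integrable fun x => M l (ψ' l x • u x) := fun l =>
    (M l).integrable_comp (integrable_schwartz_smul _ _)
  have hint2 : Integrable fun x => ψ x • (T u) x := integrable_schwartz_smul _ _
  have h1 : weakGenerator A T ψ u = ∫ x, ((∑ l, M l (ψ' l x • u x)) - ψ x • (T u) x) := by
    rw [integral_sub (integrable_finsetSum _ fun l _ => hint l) hint2,
      integral_finsetSum _ fun l _ => hint l]
    simp only [weakGenerator, _root_.sub_apply, _root_.sum_apply,
      ContinuousLinearMap.comp_apply]
    congr 1
    · refine Finset.sum_congr rfl fun l _ => ?_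
      rw [schwartzPairing_apply, ← ContinuousLinearMap.integral_comp_comm _
        (integrable_schwartz_smul _ _)]
    · rw [schwartzPairing_apply]
  have h2 : Integrable fun x => (∑ l, M l (ψ' l x • u x)) - ψ x • (T u) x :=
    (integrable_finsetSum _ fun l _ => hint l).sub hint2
  rw [h1, integral_euclidean_apply h2]
  refine integral_congr_ae ?_
  filter_upwards [hT u] with x hx
  simp [hx, M, ψ', SchwartzMap.lineDerivOp_apply_eq_fderiv]

/-- For each `ψ` the weak equation is integrated in time; the time integral then moves inside the
pairings, which are continuous and linear. -/
theorem isSolution_iff_isMildSolution {A : Fin d → Matrix ι ι ℂ}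
    {B : EuclideanSpace ℝ (Fin d) → Matrix ι ι ℂ} {T : L2Space d ι →L[ℂ] L2Space d ι}
    (hT : ∀ u, T u =ᵐ[volume] fun x => Matrix.toEuclideanCLM (𝕜 := ℂ) (B x) (u x))
    {U : ℝ → L2Space d ι} :
    IsSolution A B U ↔ IsMildSolution (hyperbolicGraph A) (T.restrictScalars ℝ) U := by
  refine and_congr_right fun hU => ?_
  have hfU : ∀ ψ, ContinuousOn (fun s => schwartzPairing ι ψ (U s)) (Ici 0) := fun ψ =>
    (schwartzPairing ι ψ).continuous.comp_continuousOn hU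
  have hgU : ∀ ψ, ContinuousOn (fun s => weakGenerator A T ψ (U s)) (Ici 0) := fun ψ =>
    (weakGenerator A T ψ).continuous.comp_continuousOn hU
  have h1 : ∀ (ψ : 𝓢(EuclideanSpace ℝ (Fin d), ℂ)) (i : ι) (u : L2Space d ι),
      ∫ x, ψ x * (u x) i = schwartzPairing ι ψ u i := fun ψ i u => by
    rw [schwartzPairing_apply, integral_euclidean_apply (integrable_schwartz_smul _ _)]
    simp
  simp only [h1, ← weakGenerator_apply_apply A hT]
  have h2 : ∀ ψ : 𝓢(EuclideanSpace ℝ (Fin d), ℂ),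
      (∀ i, ∀ t ∈ Ici (0 : ℝ), HasDerivWithinAt (fun s => schwartzPairing ι ψ (U s) i)
        (weakGenerator A T ψ (U t) i) (Ici 0) t) ↔
      ∀ t ∈ Ici (0 : ℝ), HasDerivWithinAt (fun s => schwartzPairing ι ψ (U s))
        (weakGenerator A T ψ (U t)) (Ici 0) t := by
    intro ψ
    constructor
    · intro h t ht
      have := (hasDerivWithinAt_pi.2 fun i => h i t ht)
      exact ((PiLp.continuousLinearEquiv 2 ℝ (fun _ : ι => ℂ)).symm :
        (ι → ℂ) →L[ℝ] EuclideanSpace ℂ ι).hasFDerivAt.comp_hasDerivWithinAt t this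
    · intro h i t ht
      exact ((EuclideanSpace.proj (𝕜 := ℂ) i).restrictScalars ℝ).hasFDerivAt.comp_hasDerivWithinAt
        t (h t ht)
  simp only [h2, hasDerivWithinAt_Ici_iff_integral (hfU _) (hgU _), mem_hyperbolicGraph]
  rw [forall_comm]
  refine forall_congr' fun t => ?_
  rw [forall_comm]
  refine forall_congr' fun ht => forall_congr' fun ψ => ?_
  have hi := intervalIntegrable_of_continuousOn_Ici hU (mem_Ici.1 ht)
  rw [ContinuousLinearMap.intervalIntegral_comp_comm _ hi,
    ContinuousLinearMap.intervalIntegral_comp_comm _ hi, map_add, map_sub]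
  simp only [weakGenerator, _root_.sub_apply, _root_.sum_apply,
      ContinuousLinearMap.comp_apply, ContinuousLinearMap.coe_restrictScalars']
  rw [eq_sub_iff_add_eq]

theorem stronglyWellPosed_iff_mildlyWellPosed {A : Fin d → Matrix ι ι ℂ}
    {B : EuclideanSpace ℝ (Fin d) → Matrix ι ι ℂ} {T : L2Space d ι →L[ℂ] L2Space d ι}
    (hT : ∀ u, T u =ᵐ[volume] fun x => Matrix.toEuclideanCLM (𝕜 := ℂ) (B x) (u x)) :
    StronglyWellPosed A B ↔ MildlyWellPosed (hyperbolicGraph A) (T.restrictScalars ℝ) := by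
  simp only [StronglyWellPosed, MildlyWellPosed, isSolution_iff_isMildSolution hT]

/-- Multiplication of `L²` functions by a bounded operator-valued function. -/
def mulLinftyCLM {m : EuclideanSpace ℝ (Fin d) → EuclideanSpace ℂ ι →L[ℂ] EuclideanSpace ℂ ι}
    (hm : MemLp m ∞ volume) : L2Space d ι →L[ℂ] L2Space d ι :=
  (ContinuousLinearMap.id ℂ (EuclideanSpace ℂ ι →L[ℂ] EuclideanSpace ℂ ι)).holderL
    volume ∞ 2 2 (hm.toLp m)

omit [DecidableEq ι] in
theorem coeFn_mulLinftyCLM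
    {m : EuclideanSpace ℝ (Fin d) → EuclideanSpace ℂ ι →L[ℂ] EuclideanSpace ℂ ι}
    (hm : MemLp m ∞ volume) (u : L2Space d ι) :
    mulLinftyCLM hm u =ᵐ[volume] fun x => m x (u x) := by
  have := ContinuousLinearMap.coeFn_holder (r := 2)
    (ContinuousLinearMap.id ℂ (EuclideanSpace ℂ ι →L[ℂ] EuclideanSpace ℂ ι)) (hm.toLp m) u
  filter_upwards [this, hm.coeFn_toLp] with x h1 h2
  rw [h2] at h1
  exact h1

end Bridge

/-! ### The bounded multipliers provided by ellipticity. -/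

section Multiplier

open scoped FourierTransform

variable {d : ℕ} {ι : Type} [Fintype ι] [DecidableEq ι]

theorem isUnit_symbolCLM {A : Fin d → Matrix ι ι ℂ} (hell : IsEllipticGenerator A)
    {ξ : EuclideanSpace ℝ (Fin d)} (hξ : ξ ≠ 0) : IsUnit (symbolCLM A ξ) := by
  have h1 : symbolCLM A ξ = Matrix.toEuclideanCLM (𝕜 := ℂ) (∑ l, (ξ l : ℂ) • A l) := by
    simp only [symbolCLM, map_sum, map_smul]
  rw [h1]
  refine IsUnit.map _ ((Matrix.isUnit_iff_isUnit_det _).2 (isUnit_iff_ne_zero.2 (hell ξ.ofLp ?_)))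
  simpa using hξ

/-- The symbol `ξₗ Aₗ (∑ₖ ξₖ Aₖ)⁻¹`, homogeneous of degree zero. -/
def rieszSymbol (A : Fin d → Matrix ι ι ℂ) (l : Fin d) (ξ : EuclideanSpace ℝ (Fin d)) :
    EuclideanSpace ℂ ι →L[ℂ] EuclideanSpace ℂ ι :=
  ((ξ l : ℂ) • Matrix.toEuclideanCLM (𝕜 := ℂ) (A l)) * Ring.inverse (symbolCLM A ξ)

theorem continuousOn_rieszSymbol {A : Fin d → Matrix ι ι ℂ} (hell : IsEllipticGenerator A)
    (l : Fin d) : ContinuousOn (rieszSymbol A l) {0}ᶜ := by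
  intro ξ hξ
  obtain ⟨a, ha⟩ := isUnit_symbolCLM hell hξ
  have h1 : ContinuousAt (fun ξ => Ring.inverse (symbolCLM A ξ)) ξ := by
    refine ContinuousAt.comp (g := Ring.inverse) ?_ (continuous_symbolCLM A).continuousAt
    rw [← ha]
    exact NormedRing.inverse_continuousAt a
  have h2 : Continuous fun ξ : EuclideanSpace ℝ (Fin d) =>
      (ξ l : ℂ) • Matrix.toEuclideanCLM (𝕜 := ℂ) (A l) := by fun_prop
  exact (h2.continuousAt.mul h1).continuousWithinAt

theorem rieszSymbol_smul {A : Fin d → Matrix ι ι ℂ} (hell : IsEllipticGenerator A) (l : Fin d)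
    {c : ℝ} (hc : c ≠ 0) {ξ : EuclideanSpace ℝ (Fin d)} (hξ : ξ ≠ 0) :
    rieszSymbol A l (c • ξ) = rieszSymbol A l ξ := by
  have hc' : (c : ℂ) ≠ 0 := by exact_mod_cast hc
  obtain ⟨a, ha⟩ := isUnit_symbolCLM hell hξ
  have h1 : symbolCLM A (c • ξ) = (c : ℂ) • symbolCLM A ξ := by
    simp [symbolCLM, Finset.smul_sum, smul_smul]
  have h2 : Ring.inverse ((c : ℂ) • symbolCLM A ξ) = (c : ℂ)⁻¹ • Ring.inverse (symbolCLM A ξ) := by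
    rw [← ha, Ring.inverse_unit]
    exact Ring.inverse_unit ⟨(c : ℂ) • (a : EuclideanSpace ℂ ι →L[ℂ] EuclideanSpace ℂ ι),
      (c : ℂ)⁻¹ • ↑a⁻¹, by
        rw [smul_mul_smul_comm, Units.mul_inv, mul_inv_cancel₀ hc', one_smul], by
        rw [smul_mul_smul_comm, Units.inv_mul, inv_mul_cancel₀ hc', one_smul]⟩
  rw [rieszSymbol, rieszSymbol, h1, h2]
  simp only [smul_mul_assoc, mul_smul_comm, smul_smul, PiLp.smul_apply, smul_eq_mul,
    Complex.ofReal_mul]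
  congr 1
  field_simp

/-- The index `l` forces `d ≥ 1`; for `d = 0` the origin has full measure. -/
theorem ae_ne_zero_euclidean (l : Fin d) : ∀ᵐ ξ : EuclideanSpace ℝ (Fin d), ξ ≠ 0 := by
  have : Nonempty (Fin d) := ⟨l⟩
  exact compl_mem_ae_iff.2 (measure_singleton 0)

/-- By homogeneity the symbol is bounded off the origin by its maximum on the compact unit sphere,
where it is continuous. -/
theorem memLp_rieszSymbol {A : Fin d → Matrix ι ι ℂ} (hell : IsEllipticGenerator A)
    (l : Fin d) : MemLp (rieszSymbol A l) ∞ volume := by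
  have hcont := continuousOn_rieszSymbol hell l
  have hsub : Metric.sphere (0 : EuclideanSpace ℝ (Fin d)) 1 ⊆ {0}ᶜ := fun ξ hξ h => by
    simp [mem_singleton_iff.1 h] at hξ
  obtain ⟨C, hC⟩ := (isCompact_sphere (0 : EuclideanSpace ℝ (Fin d)) 1).exists_bound_of_continuousOn
    (hcont.mono hsub)
  have hae := ae_ne_zero_euclidean l
  refine memLp_top_of_bound ?_ C ?_
  · have h1 := hcont.aestronglyMeasurable (μ := volume) (measurableSet_singleton 0).compl
    rwa [Measure.restrict_eq_self_of_ae_mem (s := {0}ᶜ) hae] at h1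
  · filter_upwards [hae] with ξ hξ
    have h0 : ‖ξ‖ ≠ 0 := norm_ne_zero_iff.2 hξ
    rw [← rieszSymbol_smul hell l (inv_ne_zero h0) hξ]
    exact hC _ (by simp [norm_smul, h0])

/-- The Fourier multiplier `Aₗ ∂ₗ L(0,∂)⁻¹`. -/
def rieszOperator {A : Fin d → Matrix ι ι ℂ} (hell : IsEllipticGenerator A) (l : Fin d) :
    L2Space d ι →L[ℂ] L2Space d ι :=
  ((Lp.fourierTransformₗᵢ (EuclideanSpace ℝ (Fin d)) (EuclideanSpace ℂ ι)).symm :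
      L2Space d ι →L[ℂ] L2Space d ι) ∘L mulLinftyCLM (memLp_rieszSymbol hell l) ∘L
    (Lp.fourierTransformₗᵢ (EuclideanSpace ℝ (Fin d)) (EuclideanSpace ℂ ι) :
      L2Space d ι →L[ℂ] L2Space d ι)

theorem fourier_rieszOperator {A : Fin d → Matrix ι ι ℂ} (hell : IsEllipticGenerator A)
    (l : Fin d) (f : L2Space d ι) :
    (𝓕 (rieszOperator hell l f) : L2Space d ι) =
      mulLinftyCLM (memLp_rieszSymbol hell l) (𝓕 f) :=
  (Lp.fourierTransformₗᵢ (EuclideanSpace ℝ (Fin d)) (EuclideanSpace ℂ ι)).apply_symm_apply _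

/-- On the Fourier side, `Ring.inverse (symbolCLM A ξ)` cancels the symbol in the transform of `f`
for every `ξ ≠ 0`, leaving `ξₗ Aₗ`. -/
theorem rieszOperator_mem {A : Fin d → Matrix ι ι ℂ} (hell : IsEllipticGenerator A) (l : Fin d)
    {u f : L2Space d ι} (h : (u, f) ∈ hyperbolicGraph A) :
    (u, rieszOperator hell l f) ∈ hyperbolicGraph (Pi.single l (A l)) := by
  rw [mem_hyperbolicGraph_iff_fourier] at h ⊢
  rw [fourier_rieszOperator]
  filter_upwards [h, ae_ne_zero_euclidean l, coeFn_mulLinftyCLM (memLp_rieszSymbol hell l) (𝓕 f)]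
    with ξ h1 h2 h3
  obtain ⟨a, ha⟩ := isUnit_symbolCLM hell h2
  have h4 : symbolCLM (Pi.single l (A l)) ξ =
      (ξ l : ℂ) • Matrix.toEuclideanCLM (𝕜 := ℂ) (A l) := by
    rw [symbolCLM, Finset.sum_eq_single l]
    · rw [Pi.single_eq_same]
    · intro k _ hk
      rw [Pi.single_eq_of_ne hk, map_zero]
      exact smul_zero (A := EuclideanSpace ℂ ι →L[ℂ] EuclideanSpace ℂ ι) (ξ k : ℂ)
    · simp
  have h5 : rieszSymbol A l ξ * symbolCLM A ξ = (ξ l : ℂ) • Matrix.toEuclideanCLM (𝕜 := ℂ) (A l) := by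
    rw [rieszSymbol, mul_assoc, ← ha, Ring.inverse_unit, Units.inv_mul, mul_one]
  rw [h3, h1, map_smul, h4, ← h5]
  rfl

omit [DecidableEq ι] in
theorem schwartzPairing_compLpL {κ : Type} [Fintype κ]
    (L : EuclideanSpace ℂ ι →L[ℂ] EuclideanSpace ℂ κ)
    (ψ : SchwartzMap (EuclideanSpace ℝ (Fin d)) ℂ) (u : L2Space d ι) :
    schwartzPairing κ ψ (L.compLpL 2 volume u) = L (schwartzPairing ι ψ u) := by
  rw [schwartzPairing_apply, schwartzPairing_apply,
    ← ContinuousLinearMap.integral_comp_comm _ (integrable_schwartz_smul _ _)]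
  refine integral_congr_ae ?_
  filter_upwards [L.coeFn_compLpL (p := 2) (μ := volume) u] with x hx
  rw [hx, map_smul]

theorem mem_hyperbolicGraph_single {A : Fin d → Matrix ι ι ℂ} {l : Fin d} {u f : L2Space d ι} :
    (u, f) ∈ hyperbolicGraph (Pi.single l (A l)) ↔
      ∀ ψ : SchwartzMap (EuclideanSpace ℝ (Fin d)) ℂ, schwartzPairing ι ψ f =
        Matrix.toEuclideanCLM (𝕜 := ℂ) (A l) (schwartzPairing ι
          (LineDeriv.lineDerivOp (EuclideanSpace.single l (1 : ℝ)) ψ) u) := by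
  rw [mem_hyperbolicGraph]
  refine forall_congr' fun ψ => ?_
  rw [Finset.sum_eq_single l]
  · simp
  · intro k _ hk; simp [Pi.single_eq_of_ne hk]
  · simp

theorem hyperbolicGraph_sum_mem {A : Fin d → Matrix ι ι ℂ} {u : L2Space d ι}
    {f : Fin d → L2Space d ι} (h : ∀ l, (u, f l) ∈ hyperbolicGraph (Pi.single l (A l))) :
    (u, ∑ l, f l) ∈ hyperbolicGraph A := by
  rw [mem_hyperbolicGraph]
  intro ψ
  rw [map_sum]
  exact Finset.sum_congr rfl fun l _ => mem_hyperbolicGraph_single.1 (h l) ψ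

theorem hyperbolicGraph_unique {A : Fin d → Matrix ι ι ℂ} {u f g : L2Space d ι}
    (hf : (u, f) ∈ hyperbolicGraph A) (hg : (u, g) ∈ hyperbolicGraph A) : f = g :=
  eq_of_schwartzPairing fun φ => (hf φ).trans (hg φ).symm

end Multiplier

/-! ### Block structure of the split system and its absorption. -/

section Split

variable {d N : ℕ}

/-- The component `Uʲ` of a split vector. -/
def blockProj (N : ℕ) (j : Fin d) :
    EuclideanSpace ℂ (Fin d × Fin N) →L[ℂ] EuclideanSpace ℂ (Fin N) :=
  LinearMap.toContinuousLinearMap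
    { toFun := fun v => WithLp.toLp 2 fun k => v (j, k)
      map_add' := fun v w => by ext; simp
      map_smul' := fun c v => by ext; simp }

/-- The split vector with `j`-th component given and other components zero. -/
def blockIncl (N : ℕ) (j : Fin d) :
    EuclideanSpace ℂ (Fin N) →L[ℂ] EuclideanSpace ℂ (Fin d × Fin N) :=
  LinearMap.toContinuousLinearMap
    { toFun := fun v => WithLp.toLp 2 fun p => if p.1 = j then v p.2 else 0
      map_add' := fun v w => by ext p; by_cases h : p.1 = j <;> simp [h]
      map_smul' := fun c v => by ext p; by_cases h : p.1 = j <;> simp [h] }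

@[simp] theorem blockProj_apply (j : Fin d) (v : EuclideanSpace ℂ (Fin d × Fin N)) (k : Fin N) :
    blockProj N j v k = v (j, k) := rfl

@[simp] theorem blockIncl_apply (j : Fin d) (v : EuclideanSpace ℂ (Fin N)) (p : Fin d × Fin N) :
    blockIncl N j v p = if p.1 = j then v p.2 else 0 := rfl

theorem blockProj_blockIncl (i j : Fin d) (v : EuclideanSpace ℂ (Fin N)) :
    blockProj N i (blockIncl N j v) = if i = j then v else 0 := by
  ext k; by_cases h : i = j <;> simp [h]

theorem sum_blockIncl_blockProj (v : EuclideanSpace ℂ (Fin d × Fin N)) :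
    ∑ j, blockIncl N j (blockProj N j v) = v := by
  ext ⟨i, k⟩; simp

/-- The sum `∑ⱼ Uʲ` of the components of a split vector. -/
def blockSum (d N : ℕ) : EuclideanSpace ℂ (Fin d × Fin N) →L[ℂ] EuclideanSpace ℂ (Fin N) :=
  ∑ j, blockProj N j

theorem toEuclideanCLM_splitCoeff (A : Fin d → Matrix (Fin N) (Fin N) ℂ) (l : Fin d)
    (v : EuclideanSpace ℂ (Fin d × Fin N)) :
    Matrix.toEuclideanCLM (𝕜 := ℂ) (splitCoeff A l) v =
      blockIncl N l (Matrix.toEuclideanCLM (𝕜 := ℂ) (A l) (blockSum d N v)) := by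
  ext ⟨i, k⟩
  by_cases h : i = l
  · simp [splitCoeff, h, Matrix.mulVec, dotProduct, blockSum, Fintype.sum_prod_type]
  · simp [splitCoeff, h, Matrix.mulVec, dotProduct]

/-- Blockwise description of the split generator. -/
theorem mem_hyperbolicGraph_splitCoeff {A : Fin d → Matrix (Fin N) (Fin N) ℂ}
    {u f : L2Space d (Fin d × Fin N)} :
    (u, f) ∈ hyperbolicGraph (splitCoeff A) ↔
      ∀ l, ((blockSum d N).compLpL 2 volume u, (blockProj N l).compLpL 2 volume f) ∈
        hyperbolicGraph (Pi.single l (A l)) := by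
  simp only [mem_hyperbolicGraph_single]
  simp only [mem_hyperbolicGraph, schwartzPairing_compLpL,
    toEuclideanCLM_splitCoeff]
  rw [forall_comm]
  refine forall_congr' fun ψ => ⟨fun h l => ?_, fun h => ?_⟩
  · rw [h, map_sum]
    simp only [blockProj_blockIncl]
    simp
  · rw [← sum_blockIncl_blockProj (schwartzPairing _ ψ f)]
    exact Finset.sum_congr rfl fun l _ => by rw [h l]

theorem compLpL_apply_eq_sum {ι κ : Type} [Fintype ι] [Fintype κ]
    (L : EuclideanSpace ℂ ι →L[ℂ] EuclideanSpace ℂ κ)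
    {L' : Fin d → EuclideanSpace ℂ ι →L[ℂ] EuclideanSpace ℂ κ} (h : ∀ v, L v = ∑ j, L' j v)
    (u : L2Space d ι) :
    L.compLpL 2 volume u = ∑ j, (L' j).compLpL 2 volume u :=
  eq_of_schwartzPairing fun φ => by
    simp only [map_sum, schwartzPairing_compLpL, h]

theorem mildlyWellPosed_splitCoeff {A : Fin d → Matrix (Fin N) (Fin N) ℂ}
    (hell : IsEllipticGenerator A) (h : MildlyWellPosed (hyperbolicGraph A) 0) :
    MildlyWellPosed (hyperbolicGraph (splitCoeff A)) 0 := by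
  let S := (blockSum d N).compLpL 2 (volume : Measure (EuclideanSpace ℝ (Fin d)))
  let pr := fun l : Fin d => (blockProj N l).compLpL 2 (volume : Measure (EuclideanSpace ℝ (Fin d)))
  -- The slaving map is `f ↦ (R₁f, …, R_d f)`, with `S` summing the components.
  let P : L2Space d (Fin N) →L[ℂ] L2Space d (Fin d × Fin N) :=
    ∑ l, (blockIncl N l).compLpL 2 volume ∘L rieszOperator hell l
  have hPapp : ∀ f, P f = ∑ l, (blockIncl N l).compLpL 2 volume (rieszOperator hell l f) :=
    fun f => by simp [P]
  have hprP : ∀ l f, pr l (P f) = rieszOperator hell l f := fun l f =>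
    eq_of_schwartzPairing fun φ => by
      simp only [pr, hPapp, map_sum, schwartzPairing_compLpL, blockProj_blockIncl]
      simp
  have hSpr : ∀ f, S f = ∑ l, pr l f := fun f =>
    compLpL_apply_eq_sum _ (fun v => by simp [blockSum]) f
  have hunique : ∀ f g : L2Space d (Fin d × Fin N), (∀ l, pr l f = pr l g) → f = g :=
    fun f g hfg => eq_of_schwartzPairing fun φ => by
      rw [← sum_blockIncl_blockProj (schwartzPairing _ φ f),
        ← sum_blockIncl_blockProj (schwartzPairing _ φ g)]
      refine Finset.sum_congr rfl fun l _ => ?_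
      have := congrArg (fun w => schwartzPairing _ φ w) (hfg l)
      simp only [pr, schwartzPairing_compLpL] at this
      rw [this]
  refine MildlyWellPosed.of_slaved (S.restrictScalars ℝ) (P.restrictScalars ℝ) (fun u f huf => ?_)
    (fun u f huf => ?_) (fun u f huf => ?_) h
  · have h1 := mem_hyperbolicGraph_splitCoeff.1 huf
    have h2 : (S u, S f) ∈ hyperbolicGraph A := by
      rw [hSpr f]; exact hyperbolicGraph_sum_mem h1
    exact ⟨h2, hunique _ _ fun l => (hyperbolicGraph_unique (h1 l)
      (rieszOperator_mem hell l h2)).trans (hprP l _).symm⟩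
  · refine mem_hyperbolicGraph_splitCoeff.2 fun l => ?_
    change (S u, pr l (P f)) ∈ _
    rw [hprP]
    exact rieszOperator_mem hell l huf
  · change S (P f) = f
    rw [hSpr]
    simp only [hprP]
    exact hyperbolicGraph_unique (hyperbolicGraph_sum_mem fun l => rieszOperator_mem hell l huf) huf

theorem memLp_top_comp_coord {σ : ℝ → ℂ} (hσ : MemLp σ ∞ (volume : Measure ℝ)) (j : Fin d) :
    MemLp (fun x : EuclideanSpace ℝ (Fin d) => σ (x j)) ∞ volume := by
  -- Coordinate projections pull null sets back to null sets, so essential bounds on `σ` survive the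
  -- composition.
  have hq : Measure.QuasiMeasurePreserving (fun x : EuclideanSpace ℝ (Fin d) => x j)
      volume volume :=
    (Measure.quasiMeasurePreserving_eval (fun _ : Fin d => (volume : Measure ℝ)) j).comp
      (PiLp.volume_preserving_ofLp (Fin d)).quasiMeasurePreserving
  refine memLp_top_of_bound (hσ.1.comp_quasiMeasurePreserving hq)
    (eLpNormEssSup σ volume).toReal
    (hq.ae (p := fun y => ‖σ y‖ ≤ (eLpNormEssSup σ volume).toReal) ?_)
  have hfin : eLpNormEssSup σ volume < ∞ := by simpa using hσ.2
  filter_upwards [ae_le_eLpNormEssSup (f := σ) (μ := volume)] with x hx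
  simpa using ENNReal.toReal_mono hfin.ne hx

theorem memLp_sum_smul {α κ W : Type*} [MeasurableSpace α] {μ : Measure α} [Fintype κ]
    [NormedAddCommGroup W] [NormedSpace ℂ W] {p : ℝ≥0∞} {g : κ → α → ℂ}
    (hg : ∀ k, MemLp (g k) p μ) (w : κ → W) : MemLp (fun x => ∑ k, g k x • w k) p μ :=
  memLp_finsetSum _ fun k _ =>
    (ContinuousLinearMap.toSpanSingleton ℂ (w k)).comp_memLp' (hg k)

theorem memLp_toEuclideanCLM_splitAbsorption (N : ℕ) {σ : Fin d → ℝ → ℂ}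
    (hσ : ∀ j, MemLp (σ j) ∞ (volume : Measure ℝ)) :
    MemLp (fun x => Matrix.toEuclideanCLM (𝕜 := ℂ) (splitAbsorption N σ x)) ∞ volume := by
  have h := memLp_sum_smul (fun p : Fin d × Fin N => memLp_top_comp_coord (hσ p.1) p.1)
    fun p => Matrix.toEuclideanCLM (𝕜 := ℂ) (Matrix.diagonal (Pi.single p (1 : ℂ)))
  refine h.ae_eq (ae_of_all _ fun x => ?_)
  ext v p
  simp [splitAbsorption, Matrix.mulVec_diagonal, Pi.single_apply]

end Split

end

theorem theorem3p2 (d N : ℕ) (A : Fin d → Matrix (Fin N) (Fin N) ℂ)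
    (hL : StronglyWellPosed A 0) (hell : IsEllipticGenerator A)
    (σ : Fin d → ℝ → ℂ) (hσ : ∀ j, MemLp (σ j) ∞ (volume : Measure ℝ)) :
    StronglyWellPosed (splitCoeff A) (splitAbsorption N σ) := by
  have h0 : MildlyWellPosed (hyperbolicGraph A) 0 :=
    (stronglyWellPosed_iff_mildlyWellPosed (T := 0) fun u => by
      filter_upwards [Lp.coeFn_zero (EuclideanSpace ℂ (Fin N)) 2
        (volume : Measure (EuclideanSpace ℝ (Fin d)))] with x hx
      simp).1 hL
  exact (stronglyWellPosed_iff_mildlyWellPosed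
    (coeFn_mulLinftyCLM (memLp_toEuclideanCLM_splitAbsorption N hσ))).2
      ((mildlyWellPosed_splitCoeff hell h0).perturb (isClosed_hyperbolicGraph _) _)
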